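/- Let $d\ge 1$ and let $\nu$ be a symmetric Lévy measure on $\mathbb{R}^d$, i.e. a Borel measure with $\int_{\mathbb{R}^d}(1\wedge|y|^2)\,\nu(dy)<\infty$ and $\nu(-D)=\nu(D)$ for every Borel set $D\subset\mathbb{R}^d$. Put $$\Phi(\xi)=\int_{\mathbb{R}^d}\bigl(1-\cos\langle\xi,y\rangle\bigr)\,\nu(dy),\qquad \Psi(r)=\sup_{|\xi|\le r}\Phi(\xi),$$ $$\Psi^{-1}(s)=\sup\{r>0:\Psi(r)=s\},\qquad h(t)=\frac{1}{\Psi^{-1}(1/t)}\quad(r,s,t>0),$$ and let $\{P_t\}_{t\ge0}$ be the convolution semigroup of probability measures on $\mathbb{R}^d$ with $\int_{\mathbb{R}^d} e^{i\langle\xi,y\rangle}\,P_t(dy)=e^{-t\Phi(\xi)}$. Assume that there is a constant $M_0>0$ such that $$\int_{\mathbb{R}^d}e^{-t\Phi(\xi)}|\xi|\,d\xi\le M_0\,h(t)^{-d-1}\qquad\text{for all } t\in(0,\infty)$$ (this forces $\nu(\mathbb{R}^d)=\infty$). Then for every $t>0$ the measure $P_t$ has a continuous density $p_t$ with respect to Lebesgue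 measure, and there exist positive constants $c_1,c_2,c_3,c_4$, which may depend on $\nu$ (and $d$), such that $$p_t(x)\ge c_1\,h(t)^{-d}\,e^{-c_2|x|^2/t}\qquad\text{for all } t>c_3 \text{ and } |x|\le c_4t.$$ -/

import Mathlib

open MeasureTheory Set
open scoped ENNReal RealInnerProductSpace

namespace LevyDensity

/-- A symmetric Lévy measure on `ℝ^d`: a Borel measure `ν` with `∫ (1 ∧ |y|²) ν(dy) < ∞` and
`ν(-D) = ν(D)` for all Borel sets `D`. (An atom at the origin is not excluded; it would have no
effect on any of the notions below. Nor is `ν(ℝ^d) = ∞` required here: it follows from the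
condition `FourierCondition` below when `d ≥ 1`.) -/
structure IsSymmetricLevyMeasure {d : ℕ} (ν : Measure (EuclideanSpace ℝ (Fin d))) : Prop where
  lintegral_lt_top : ∫⁻ y, ENNReal.ofReal (min 1 (‖y‖ ^ 2)) ∂ν < ∞
  symmetric : ∀ D : Set (EuclideanSpace ℝ (Fin d)), MeasurableSet D →
    ν ((fun y => -y) ⁻¹' D) = ν D

/-- The characteristic exponent `Φ(ξ) = ∫ (1 - cos ⟨ξ, y⟩) ν(dy)`. -/
noncomputable def Phi {d : ℕ} (ν : Measure (EuclideanSpace ℝ (Fin d)))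
    (ξ : EuclideanSpace ℝ (Fin d)) : ℝ :=
  ∫ y, (1 - Real.cos ⟪ξ, y⟫) ∂ν

/-- `Ψ(r) = sup_{|ξ| ≤ r} Φ(ξ)`. -/
noncomputable def Psi {d : ℕ} (ν : Measure (EuclideanSpace ℝ (Fin d))) (r : ℝ) : ℝ :=
  sSup (Phi ν '' Metric.closedBall 0 r)

/-- The generalized inverse `Ψ⁻¹(s) = sup {r > 0 : Ψ(r) = s}`. -/
noncomputable def PsiInv {d : ℕ} (ν : Measure (EuclideanSpace ℝ (Fin d))) (s : ℝ) : ℝ :=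
  sSup {r : ℝ | 0 < r ∧ Psi ν r = s}

/-- `h(t) = 1 / Ψ⁻¹(1/t)`. -/
noncomputable def h {d : ℕ} (ν : Measure (EuclideanSpace ℝ (Fin d))) (t : ℝ) : ℝ :=
  1 / PsiInv ν (1 / t)

/-- The Fourier integrability condition up to time `tp ∈ (0, ∞]`: for some `M₀ > 0`,
`∫ e^{-tΦ(ξ)} |ξ| dξ ≤ M₀ h(t)^{-d-1}` for all `t ∈ (0, tp)`. The left-hand side is an
integral with values in `[0, ∞]`, so its finiteness is part of the condition. -/
def FourierCondition {d : ℕ} (ν : Measure (EuclideanSpace ℝ (Fin d))) (tp : ℝ≥0∞) : Prop :=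
  ∃ M₀ : ℝ, 0 < M₀ ∧ ∀ t : ℝ, 0 < t → ENNReal.ofReal t < tp →
    ∫⁻ ξ : EuclideanSpace ℝ (Fin d), ENNReal.ofReal (Real.exp (-t * Phi ν ξ) * ‖ξ‖) ≤
      ENNReal.ofReal (M₀ * h ν t ^ (-(d : ℤ) - 1))

/-- `(P_t)_{t ≥ 0}` is the convolution semigroup of probability measures on `ℝ^d` with Fourier
transform `∫ e^{i⟨ξ, y⟩} P_t(dy) = e^{-tΦ(ξ)}`. The Fourier transform determines every `P_t`,
and gives `P_0 = δ_0` and `P_{s+t} = P_s * P_t`. -/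
structure IsLevySemigroup {d : ℕ} (ν : Measure (EuclideanSpace ℝ (Fin d)))
    (P : ℝ → Measure (EuclideanSpace ℝ (Fin d))) : Prop where
  isProbabilityMeasure : ∀ t : ℝ, 0 ≤ t → IsProbabilityMeasure (P t)
  charFun_eq : ∀ t : ℝ, 0 ≤ t → ∀ ξ : EuclideanSpace ℝ (Fin d),
    charFun (P t) ξ = Complex.exp (-(t : ℂ) * (Phi ν ξ : ℂ))

/-- `p` is the continuous density of `μ` with respect to Lebesgue measure. -/
structure IsContinuousDensity {d : ℕ} (μ : Measure (EuclideanSpace ℝ (Fin d)))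
    (p : EuclideanSpace ℝ (Fin d) → ℝ) : Prop where
  continuous : Continuous p
  nonneg : ∀ x, 0 ≤ p x
  eq_withDensity : μ = volume.withDensity (fun x => ENNReal.ofReal (p x))

end LevyDensity

/-! Since `Φ ≥ 0`, the hypothesis makes `e^{-tΦ}` integrable, so Fourier inversion gives a
continuous density and `(2π)^d p_t(x) ≥ ∫ e^{-tΦ} - |x| ∫ |ξ| e^{-tΦ}`. On `|ξ| ≤ 1/h(t)` one has
`tΦ ≤ 1`, so the first integral is at least of order `h(t)^{-d}`; the second is at most `M₀
h(t)^{-d-1}`. Hence `p_t ≥ a h(t)^{-d}` on `|x| ≤ θ h(t)` (`exists_near_diagonal_le`).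

Farther away, `t` is cut into `k + 1` equal times `s` and Chapman–Kolmogorov is iterated along a
chain of balls of size `h(s)` (`IsLevySemigroup.chain_le`). Each additional link costs a factor `q`
independent of `s`, because the powers of `h(s)` cancel. The chain must reach `x`, i.e. `k h(s) ≳
|x|`. The inequality `Φ(2ξ) ≤ 4Φ(ξ)` gives `Ψ(r) ≳ r²` for `r ≤ 1`, hence `h(s)² ≳ s` for large `s`
(`exists_mul_le_h_sq`), so `k ≈ |x|²/t` links suffice and `q^k` is the Gaussian factor. The
restriction `|x| ≤ c₄ t` keeps `s` large. -/

namespace LevyDensity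

open Filter Topology

/-! ### Fourier inversion for measures with integrable real characteristic function -/

section FourierInversion

open FourierTransform SchwartzMap ContDiff

/-- The inverse Fourier transform (for the convention `e^{i⟨x, ξ⟩}`) of a real even function. -/
noncomputable def fourierDensity {d : ℕ} (φ : EuclideanSpace ℝ (Fin d) → ℝ)
    (x : EuclideanSpace ℝ (Fin d)) : ℝ :=
  ((2 * Real.pi) ^ d)⁻¹ * ∫ ξ, Real.cos ⟪x, ξ⟫ * φ ξ

lemma integrable_cos_mul {d : ℕ} {φ : EuclideanSpace ℝ (Fin d) → ℝ} (hφ : Integrable φ)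
    (x : EuclideanSpace ℝ (Fin d)) : Integrable fun ξ => Real.cos ⟪x, ξ⟫ * φ ξ :=
  hφ.bdd_mul (c := 1) (by fun_prop) (ae_of_all _ fun ξ => by simpa using Real.abs_cos_le_one _)

lemma continuous_fourierDensity {d : ℕ} {φ : EuclideanSpace ℝ (Fin d) → ℝ}
    (hφ : Integrable φ) : Continuous (fourierDensity φ) := by
  unfold fourierDensity
  refine continuous_const.mul
    (continuous_of_dominated (bound := fun ξ => ‖φ ξ‖) ?_ ?_ hφ.norm ?_)
  · exact fun x => (integrable_cos_mul hφ x).aestronglyMeasurable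
  · intro x
    refine ae_of_all _ fun ξ => ?_
    rw [norm_mul]
    exact mul_le_of_le_one_left (norm_nonneg _) (Real.abs_cos_le_one _)
  · exact ae_of_all _ fun ξ => by fun_prop

/-- The substitution `ξ ↦ 2πξ` passes between the kernels `e^{i⟨x,ξ⟩}` and `e^{-2πi⟨x,ξ⟩}`; its
Jacobian is the factor `(2π)^{-d}`, and the sign disappears in the real part. -/
lemma fourierDensity_eq_re {d : ℕ} {φ : EuclideanSpace ℝ (Fin d) → ℝ} (hφ : Integrable φ)
    (x : EuclideanSpace ℝ (Fin d)) :
    fourierDensity φ x = (𝓕 (fun ξ => (φ ((2 * Real.pi) • ξ) : ℂ)) x).re := by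
  have hint : Integrable fun ξ => (φ ((2 * Real.pi) • ξ) : ℂ) :=
    (hφ.comp_smul (by positivity)).ofReal
  rw [Real.fourier_eq', ← RCLike.re_eq_complex_re, ← integral_re]
  · have := Measure.integral_comp_smul_of_nonneg volume
      (fun ξ => Real.cos ⟪x, ξ⟫ * φ ξ) (2 * Real.pi) (hR := by positivity)
    rw [finrank_euclideanSpace_fin, smul_eq_mul] at this
    rw [fourierDensity, ← this]
    congr 1 with ξ
    rw [smul_eq_mul, RCLike.re_eq_complex_re, Complex.re_mul_ofReal, Complex.exp_ofReal_mul_I_re,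
      real_inner_smul_right, real_inner_comm, neg_mul, neg_mul, Real.cos_neg]
  · refine hint.bdd_mul (c := 1) (by fun_prop) (ae_of_all _ fun ξ => ?_)
    rw [Complex.norm_exp_ofReal_mul_I]

/-- Self-adjointness of the Fourier transform is used twice: once to move it from `𝓕⁻ g` onto `μ`,
once to move it from `g` onto `φ`. The two sides then match after `ξ ↦ -ξ`. -/
lemma integral_schwartz_eq {d : ℕ} (μ : Measure (EuclideanSpace ℝ (Fin d))) [IsFiniteMeasure μ]
    {φ : EuclideanSpace ℝ (Fin d) → ℝ} (hφ : Integrable φ) (hμ : ∀ ξ, charFun μ ξ = φ ξ)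
    (g : 𝓢(EuclideanSpace ℝ (Fin d), ℂ)) :
    ∫ x, g x ∂μ = ∫ x, g x * 𝓕 (fun ξ => (φ ((2 * Real.pi) • ξ) : ℂ)) x := by
  have hint : Integrable fun ξ => (φ ((2 * Real.pi) • ξ) : ℂ) :=
    (hφ.comp_smul (by positivity)).ofReal
  have hL : Continuous fun p : EuclideanSpace ℝ (Fin d) × EuclideanSpace ℝ (Fin d) =>
      innerₗ (EuclideanSpace ℝ (Fin d)) p.1 p.2 := by
    simp only [innerₗ_apply_apply]; fun_prop
  set G : 𝓢(EuclideanSpace ℝ (Fin d), ℂ) := 𝓕⁻ g with hG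
  have h1 := VectorFourier.integral_fourierIntegral_smul_eq_flip (μ := μ) (ν := volume)
    (L := innerₗ (EuclideanSpace ℝ (Fin d))) (f := 1) (g := G)
    Real.continuous_fourierChar hL (integrable_const 1) G.integrable
  have h2 := VectorFourier.integral_fourierIntegral_smul_eq_flip (μ := volume) (ν := volume)
    (L := innerₗ (EuclideanSpace ℝ (Fin d))) (f := g)
    Real.continuous_fourierChar hL g.integrable hint
  have hflip : (innerₗ (EuclideanSpace ℝ (Fin d))).flip = innerₗ (EuclideanSpace ℝ (Fin d)) := by
    ext x y; simp
  rw [hflip] at h1 h2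
  have h3 : ∀ ξ, VectorFourier.fourierIntegral Real.fourierChar μ
      (innerₗ (EuclideanSpace ℝ (Fin d))) 1 ξ = (φ ((2 * Real.pi) • (-ξ)) : ℂ) := by
    intro ξ
    rw [← hμ, charFun_eq_fourierIntegral', smul_neg, neg_smul, smul_neg, neg_neg,
      inv_smul_smul₀ (by positivity)]
  have h4 : ∀ x, VectorFourier.fourierIntegral Real.fourierChar volume
      (innerₗ (EuclideanSpace ℝ (Fin d))) G x = g x := by
    intro x
    change 𝓕 (G : EuclideanSpace ℝ (Fin d) → ℂ) x = g x
    rw [← SchwartzMap.fourier_coe, hG, FourierTransform.fourier_fourierInv_eq]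
  simp only [h3, h4, Pi.one_apply, one_smul] at h1
  rw [← h1]
  change _ = ∫ x, g x • VectorFourier.fourierIntegral Real.fourierChar volume
      (innerₗ (EuclideanSpace ℝ (Fin d))) (fun ξ => (φ ((2 * Real.pi) • ξ) : ℂ)) x
  rw [← h2, ← integral_neg_eq_self]
  congr 1 with ξ
  rw [neg_neg, hG, SchwartzMap.fourierInv_coe, Real.fourierInv_eq_fourier_neg, neg_neg, smul_eq_mul,
    smul_eq_mul, mul_comm]
  rfl

lemma integral_contDiff_eq {d : ℕ} (μ : Measure (EuclideanSpace ℝ (Fin d))) [IsFiniteMeasure μ]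
    {φ : EuclideanSpace ℝ (Fin d) → ℝ} (hφ : Integrable φ) (hμ : ∀ ξ, charFun μ ξ = φ ξ)
    {f : EuclideanSpace ℝ (Fin d) → ℝ} (hf : ContDiff ℝ ∞ f) (hfc : HasCompactSupport f) :
    ∫ x, f x ∂μ = ∫ x, f x * fourierDensity φ x := by
  have hfc' : HasCompactSupport fun x => (f x : ℂ) := hfc.comp_left (g := Complex.ofReal) rfl
  have hf' : ContDiff ℝ ∞ fun x => (f x : ℂ) := Complex.ofRealCLM.contDiff.comp hf
  have h := integral_schwartz_eq μ hφ hμ (hfc'.toSchwartzMap hf')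
  simp only [HasCompactSupport.toSchwartzMap_toFun, integral_complex_ofReal] at h
  have h' := congrArg Complex.re h
  have hint : Integrable fun ξ => (φ ((2 * Real.pi) • ξ) : ℂ) :=
    (hφ.comp_smul (by positivity)).ofReal
  rw [Complex.ofReal_re, ← RCLike.re_eq_complex_re, ← integral_re] at h'
  · rw [h']
    congr 1 with x
    rw [fourierDensity_eq_re hφ, RCLike.re_eq_complex_re, Complex.re_ofReal_mul]
  · have hc : Continuous (𝓕 (fun ξ => (φ ((2 * Real.pi) • ξ) : ℂ))) :=
      VectorFourier.fourierIntegral_continuous Real.continuous_fourierChar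
        (by simp only [innerₗ_apply_apply]; fun_prop) hint
    exact (hf'.continuous.mul hc).integrable_of_hasCompactSupport hfc'.mul_right

lemma measureReal_eq_setIntegral {d : ℕ} (μ : Measure (EuclideanSpace ℝ (Fin d)))
    [IsFiniteMeasure μ] {φ : EuclideanSpace ℝ (Fin d) → ℝ} (hφ : Integrable φ)
    (hμ : ∀ ξ, charFun μ ξ = φ ξ) {U : Set (EuclideanSpace ℝ (Fin d))} (hU : IsOpen U)
    (hUb : Bornology.IsBounded U) : μ.real U = ∫ x in U, fourierDensity φ x := by
  obtain ⟨f, hfs, hf, hf01⟩ := hU.exists_contDiff_support_eq (n := ⊤)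
  have hfI : ∀ x, 0 ≤ f x ∧ f x ≤ 1 := fun x => hf01 (mem_range_self x)
  have hfc : HasCompactSupport f := by
    rw [HasCompactSupport, tsupport, hfs]
    exact hUb.isCompact_closure
  -- These are smooth, supported in the closure of `U`, bounded by 1, and converge pointwise to the
  -- indicator of `U`, so dominated convergence applies on both sides.
  let g : ℕ → EuclideanSpace ℝ (Fin d) → ℝ := fun n x => 1 - (1 - f x) ^ n
  have hg0 : ∀ n x, x ∉ U → g n x = 0 := by
    intro n x hx
    have : f x = 0 := by rwa [← hfs, Function.notMem_support] at hx
    simp [g, this]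
  have hg1 : ∀ n x, |g n x| ≤ 1 := by
    intro n x
    have h1 : 0 ≤ (1 - f x) ^ n := pow_nonneg (by linarith [(hfI x).2]) n
    have h2 : (1 - f x) ^ n ≤ 1 :=
      pow_le_one₀ (by linarith [(hfI x).2]) (by linarith [(hfI x).1])
    rw [abs_le]
    constructor <;> simp only [g] <;> linarith
  have hglim : ∀ x, Tendsto (fun n => g n x) atTop (𝓝 (U.indicator 1 x)) := by
    intro x
    by_cases hx : x ∈ U
    · have hpos : 0 < f x := lt_of_le_of_ne (hfI x).1 (by
        rw [← hfs, Function.mem_support] at hx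
        exact hx.symm)
      have := tendsto_pow_atTop_nhds_zero_of_lt_one (r := 1 - f x) (by linarith [(hfI x).2])
        (by linarith)
      simpa [hx, g] using tendsto_const_nhds.sub this
    · simp only [hg0 _ x hx, indicator_of_notMem hx]
      exact tendsto_const_nhds
  have hgd : ∀ n, ContDiff ℝ ∞ (g n) := fun n => contDiff_const.sub ((contDiff_const.sub hf).pow n)
  have hgc : ∀ n, HasCompactSupport (g n) := by
    intro n
    refine hUb.isCompact_closure.of_isClosed_subset (isClosed_tsupport _) (closure_mono ?_)
    intro x hx
    by_contra hxU
    exact hx (hg0 n x hxU)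
  have hc := continuous_fourierDensity hφ
  have hint : IntegrableOn (fourierDensity φ) U :=
    (hc.continuousOn.integrableOn_compact hUb.isCompact_closure).mono_set subset_closure
  have l1 : Tendsto (fun n => ∫ x, g n x ∂μ) atTop (𝓝 (∫ x, U.indicator 1 x ∂μ)) :=
    tendsto_integral_of_dominated_convergence (fun _ => 1)
      (fun n => (hgd n).continuous.aestronglyMeasurable) (integrable_const 1)
      (fun n => ae_of_all _ (hg1 n)) (ae_of_all _ hglim)
  have l2 : Tendsto (fun n => ∫ x, g n x * fourierDensity φ x) atTop
      (𝓝 (∫ x, U.indicator 1 x * fourierDensity φ x)) := by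
    refine tendsto_integral_of_dominated_convergence
      (U.indicator fun x => ‖fourierDensity φ x‖)
      (fun n => ((hgd n).continuous.mul hc).aestronglyMeasurable)
      ((integrable_indicator_iff hU.measurableSet).2 hint.norm)
      (fun n => ae_of_all _ fun x => ?_) (ae_of_all _ fun x => (hglim x).mul_const _)
    by_cases hx : x ∈ U
    · rw [indicator_of_mem hx, norm_mul]
      exact mul_le_of_le_one_left (norm_nonneg _) (hg1 n x)
    · simp [hg0 n x hx, hx]
  have key := tendsto_nhds_unique l1 (l2.congr fun n =>
    (integral_contDiff_eq μ hφ hμ (hgd n) (hgc n)).symm)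
  rw [integral_indicator_one hU.measurableSet] at key
  rw [key, ← integral_indicator hU.measurableSet]
  congr 1 with x
  by_cases hx : x ∈ U <;> simp [hx]

/-- By continuity, a negative value would make the integral over a small ball negative, yet that
integral is the `μ`-measure of the ball. -/
lemma fourierDensity_nonneg {d : ℕ} (μ : Measure (EuclideanSpace ℝ (Fin d)))
    [IsFiniteMeasure μ] {φ : EuclideanSpace ℝ (Fin d) → ℝ} (hφ : Integrable φ)
    (hμ : ∀ ξ, charFun μ ξ = φ ξ) (x : EuclideanSpace ℝ (Fin d)) : 0 ≤ fourierDensity φ x := by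
  by_contra! hx
  have hc := continuous_fourierDensity hφ
  have hev : ∀ᶠ y in 𝓝 x, fourierDensity φ y < fourierDensity φ x / 2 :=
    hc.continuousAt.eventually (gt_mem_nhds (by linarith))
  obtain ⟨r, hr, hball⟩ := Metric.eventually_nhds_iff_ball.1 hev
  have h1 := measureReal_eq_setIntegral μ hφ hμ Metric.isOpen_ball
    (Metric.isBounded_ball (x := x) (r := r))
  have hint : IntegrableOn (fourierDensity φ) (Metric.ball x r) :=
    (hc.continuousOn.integrableOn_compact (isCompact_closedBall x r)).mono_set
      Metric.ball_subset_closedBall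
  have h2 : ∫ y in Metric.ball x r, fourierDensity φ y
      ≤ ∫ _ in Metric.ball x r, fourierDensity φ x / 2 :=
    setIntegral_mono_on hint (integrableOn_const measure_ball_lt_top.ne)
      measurableSet_ball fun y hy => (hball y hy).le
  rw [setIntegral_const, smul_eq_mul, ← h1] at h2
  have h3 : 0 < (volume : Measure (EuclideanSpace ℝ (Fin d))).real (Metric.ball x r) :=
    ENNReal.toReal_pos (Metric.measure_ball_pos _ _ hr).ne' measure_ball_lt_top.ne
  have h4 : 0 ≤ μ.real (Metric.ball x r) := measureReal_nonneg
  nlinarith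

/-- A finite measure whose characteristic function is real and integrable has a continuous
density, given by Fourier inversion. -/
theorem isContinuousDensity_fourierDensity {d : ℕ} (μ : Measure (EuclideanSpace ℝ (Fin d)))
    [IsFiniteMeasure μ] {φ : EuclideanSpace ℝ (Fin d) → ℝ} (hφ : Integrable φ)
    (hμ : ∀ ξ, charFun μ ξ = φ ξ) : IsContinuousDensity μ (fourierDensity φ) := by
  have hc := continuous_fourierDensity hφ
  have h0 := fourierDensity_nonneg μ hφ hμ
  refine ⟨hc, h0, ?_⟩
  have hb : ∀ U : Set (EuclideanSpace ℝ (Fin d)), IsOpen U → Bornology.IsBounded U →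
      μ U = volume.withDensity (fun x => ENNReal.ofReal (fourierDensity φ x)) U := by
    intro U hU hUb
    have hint : IntegrableOn (fourierDensity φ) U :=
      (hc.continuousOn.integrableOn_compact hUb.isCompact_closure).mono_set subset_closure
    rw [withDensity_apply _ hU.measurableSet,
      ← ofReal_integral_eq_lintegral_ofReal hint (ae_of_all _ h0),
      ← measureReal_eq_setIntegral μ hφ hμ hU hUb, ofReal_measureReal]
  have ho : ∀ U : Set (EuclideanSpace ℝ (Fin d)), IsOpen U →
      μ U = volume.withDensity (fun x => ENNReal.ofReal (fourierDensity φ x)) U := by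
    intro U hU
    have hUn : U = ⋃ n : ℕ, U ∩ Metric.ball 0 (n : ℝ) := by
      rw [← inter_iUnion, Metric.iUnion_ball_nat, inter_univ]
    have hm : Monotone fun n : ℕ => U ∩ Metric.ball (0 : EuclideanSpace ℝ (Fin d)) (n : ℝ) :=
      fun m n hmn => inter_subset_inter_right _ (Metric.ball_subset_ball (by exact_mod_cast hmn))
    rw [hUn, hm.measure_iUnion, hm.measure_iUnion]
    congr 1 with n
    exact hb _ (hU.inter Metric.isOpen_ball) (Metric.isBounded_ball.subset inter_subset_right)
  exact ext_of_generate_finite {U | IsOpen U} (BorelSpace.measurable_eq) isPiSystem_isOpen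
    (fun U hU => ho U hU) (ho _ isOpen_univ)

end FourierInversion

/-! ### The characteristic exponent -/

lemma IsSymmetricLevyMeasure.integrable_one_sub_cos {d : ℕ}
    {ν : Measure (EuclideanSpace ℝ (Fin d))} (hν : IsSymmetricLevyMeasure ν)
    (ξ : EuclideanSpace ℝ (Fin d)) : Integrable (fun y => 1 - Real.cos ⟪ξ, y⟫) ν := by
  have hmin : Integrable (fun y : EuclideanSpace ℝ (Fin d) => min 1 (‖y‖ ^ 2)) ν := by
    refine ⟨by fun_prop, ?_⟩
    rw [hasFiniteIntegral_iff_ofReal (ae_of_all _ fun y => by positivity)]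
    exact hν.lintegral_lt_top
  refine (hmin.const_mul (2 + ‖ξ‖ ^ 2)).mono' (by fun_prop) (ae_of_all _ fun y => ?_)
  have h0 : 0 ≤ 1 - Real.cos ⟪ξ, y⟫ := by linarith [Real.cos_le_one ⟪ξ, y⟫]
  rw [Real.norm_of_nonneg h0]
  rcases le_total 1 (‖y‖ ^ 2) with h | h
  · rw [min_eq_left h]
    nlinarith [Real.neg_one_le_cos ⟪ξ, y⟫, sq_nonneg ‖ξ‖]
  · rw [min_eq_right h]
    have h1 := Real.one_sub_sq_div_two_le_cos (x := ⟪ξ, y⟫)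
    have h2 : ⟪ξ, y⟫ ^ 2 ≤ (‖ξ‖ * ‖y‖) ^ 2 :=
      sq_le_sq' (neg_le_of_abs_le (abs_real_inner_le_norm ξ y)) (real_inner_le_norm ξ y)
    nlinarith [sq_nonneg ‖y‖, sq_nonneg (‖ξ‖ * ‖y‖)]

lemma Phi_nonneg {d : ℕ} (ν : Measure (EuclideanSpace ℝ (Fin d)))
    (ξ : EuclideanSpace ℝ (Fin d)) : 0 ≤ Phi ν ξ :=
  integral_nonneg fun y => by simpa using Real.cos_le_one ⟪ξ, y⟫

lemma Phi_zero {d : ℕ} (ν : Measure (EuclideanSpace ℝ (Fin d))) : Phi ν 0 = 0 := by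
  simp [Phi]

/-- Pointwise, `4(1 - cos u) - (1 - cos 2u) = 2(1 - cos u)² ≥ 0`. -/
lemma IsSymmetricLevyMeasure.Phi_two_smul_le {d : ℕ}
    {ν : Measure (EuclideanSpace ℝ (Fin d))} (hν : IsSymmetricLevyMeasure ν)
    (ξ : EuclideanSpace ℝ (Fin d)) : Phi ν ((2 : ℝ) • ξ) ≤ 4 * Phi ν ξ := by
  unfold Phi
  rw [← integral_const_mul]
  refine integral_mono (hν.integrable_one_sub_cos _)
    ((hν.integrable_one_sub_cos ξ).const_mul 4) fun y => ?_
  simp only [real_inner_smul_left, Real.cos_two_mul]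
  nlinarith [sq_nonneg (1 - Real.cos ⟪ξ, y⟫)]

lemma IsLevySemigroup.charFun_eq_ofReal {d : ℕ} {ν : Measure (EuclideanSpace ℝ (Fin d))}
    {P : ℝ → Measure (EuclideanSpace ℝ (Fin d))} (hP : IsLevySemigroup ν P) {t : ℝ} (ht : 0 ≤ t)
    (ξ : EuclideanSpace ℝ (Fin d)) :
    charFun (P t) ξ = (Real.exp (-t * Phi ν ξ) : ℝ) := by
  rw [hP.charFun_eq t ht]
  push_cast
  rfl

/-- Characteristic functions are continuous, and `Φ` is minus the logarithm of that of `P 1`. -/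
lemma IsLevySemigroup.continuous_Phi {d : ℕ} {ν : Measure (EuclideanSpace ℝ (Fin d))}
    {P : ℝ → Measure (EuclideanSpace ℝ (Fin d))} (hP : IsLevySemigroup ν P) :
    Continuous (Phi ν) := by
  have := hP.isProbabilityMeasure 1 zero_le_one
  have h1 : Continuous fun ξ => Real.exp (-1 * Phi ν ξ) := by
    have h2 : Continuous fun ξ => (charFun (P 1) ξ).re :=
      Complex.continuous_re.comp continuous_charFun
    simpa only [hP.charFun_eq_ofReal zero_le_one, Complex.ofReal_re] using h2
  have h3 : Phi ν = fun ξ => -Real.log (Real.exp (-1 * Phi ν ξ)) := by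
    ext ξ
    rw [Real.log_exp]
    ring
  rw [h3]
  exact (h1.log fun ξ => (Real.exp_pos _).ne').neg

/-- If `Φ ≤ B`, the integral at `t = 1` is at least `e^{-B}` times the infinite volume of `|ξ| > 1`.
Unboundedness guarantees that `Ψ` attains every positive value. -/
lemma FourierCondition.exists_lt_Phi {d : ℕ} (hd : 1 ≤ d)
    {ν : Measure (EuclideanSpace ℝ (Fin d))} (hA : FourierCondition ν ∞) (B : ℝ) :
    ∃ ξ, B < Phi ν ξ := by
  by_contra! hB
  obtain ⟨M₀, -, hM⟩ := hA
  have : Nontrivial (EuclideanSpace ℝ (Fin d)) := by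
    have : Nonempty (Fin d) := ⟨⟨0, hd⟩⟩
    infer_instance
  have h1 := hM 1 one_pos ENNReal.ofReal_lt_top
  have hnc : volume (Metric.closedBall (0 : EuclideanSpace ℝ (Fin d)) 1)ᶜ = ∞ := by
    have := measure_add_measure_compl (μ := (volume : Measure (EuclideanSpace ℝ (Fin d))))
      (Metric.isClosed_closedBall (x := (0 : EuclideanSpace ℝ (Fin d))) (ε := 1)).measurableSet
    rw [measure_univ_of_isAddLeftInvariant, ENNReal.add_eq_top] at this
    exact this.resolve_left (measure_closedBall_lt_top).ne
  have h2 : ENNReal.ofReal (Real.exp (-B)) *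
      volume (Metric.closedBall (0 : EuclideanSpace ℝ (Fin d)) 1)ᶜ ≤
      ∫⁻ ξ : EuclideanSpace ℝ (Fin d), ENNReal.ofReal (Real.exp (-1 * Phi ν ξ) * ‖ξ‖) := by
    rw [← setLIntegral_const]
    refine (setLIntegral_mono' Metric.isClosed_closedBall.measurableSet.compl
      fun ξ hξ => ENNReal.ofReal_le_ofReal ?_).trans (setLIntegral_le_lintegral _ _)
    rw [mem_compl_iff, mem_closedBall_zero_iff, not_le] at hξ
    calc Real.exp (-B) ≤ Real.exp (-1 * Phi ν ξ) := Real.exp_le_exp.2 (by linarith [hB ξ])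
      _ ≤ _ := le_mul_of_one_le_right (Real.exp_pos _).le hξ.le
  rw [hnc, ENNReal.mul_top (by simpa using Real.exp_pos _)] at h2
  exact absurd (h2.trans h1) (by simp)

/-! ### Growth of `Ψ` and of the scale `h` -/

section Psi

variable {d : ℕ} {ν : Measure (EuclideanSpace ℝ (Fin d))}

lemma Phi_le_Psi (hc : Continuous (Phi ν)) {r : ℝ} {ξ : EuclideanSpace ℝ (Fin d)}
    (hξ : ‖ξ‖ ≤ r) : Phi ν ξ ≤ Psi ν r :=
  le_csSup ((isCompact_closedBall 0 r).image hc).bddAbove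
    (mem_image_of_mem _ (mem_closedBall_zero_iff.2 hξ))

lemma Psi_le {r B : ℝ} (hr : 0 ≤ r) (hB : ∀ ξ, ‖ξ‖ ≤ r → Phi ν ξ ≤ B) : Psi ν r ≤ B := by
  refine csSup_le ⟨_, mem_image_of_mem _ (Metric.mem_closedBall_self hr)⟩ ?_
  rintro _ ⟨ξ, hξ, rfl⟩
  exact hB ξ (mem_closedBall_zero_iff.1 hξ)

lemma Psi_mono (hc : Continuous (Phi ν)) {r s : ℝ} (hr : 0 ≤ r) (hrs : r ≤ s) :
    Psi ν r ≤ Psi ν s :=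
  Psi_le hr fun _ hξ => Phi_le_Psi hc (hξ.trans hrs)

lemma Psi_nonneg (hc : Continuous (Phi ν)) {r : ℝ} (hr : 0 ≤ r) : 0 ≤ Psi ν r :=
  (Phi_nonneg ν 0).trans (Phi_le_Psi hc (by simpa using hr))

lemma Psi_zero : Psi ν 0 = 0 := by
  simp [Psi, Phi_zero]

lemma continuousOn_Psi (hc : Continuous (Phi ν)) : ContinuousOn (Psi ν) (Ici 0) := by
  -- Rescaling turns the supremum over a varying ball into one over the fixed compact unit ball.
  have h1 : Continuous fun r : ℝ => sSup ((fun u : EuclideanSpace ℝ (Fin d) => Phi ν (r • u)) ''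
      Metric.closedBall 0 1) :=
    (isCompact_closedBall 0 1).continuous_sSup (by
      change Continuous fun p : ℝ × EuclideanSpace ℝ (Fin d) => Phi ν (p.1 • p.2)
      exact hc.comp (by fun_prop))
  refine h1.continuousOn.congr fun r hr => ?_
  beta_reduce
  rw [Psi, ← image_image (Phi ν) (fun u => r • u), image_smul, smul_unitClosedBall,
    Real.norm_of_nonneg hr]

lemma Psi_two_mul_le (hν : IsSymmetricLevyMeasure ν) (hc : Continuous (Phi ν)) {r : ℝ}
    (hr : 0 ≤ r) : Psi ν (2 * r) ≤ 4 * Psi ν r := by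
  refine Psi_le (by positivity) fun ξ hξ => ?_
  have h1 := hν.Phi_two_smul_le ((2 : ℝ)⁻¹ • ξ)
  rw [smul_inv_smul₀ two_ne_zero] at h1
  have h2 : Phi ν ((2 : ℝ)⁻¹ • ξ) ≤ Psi ν r := by
    refine Phi_le_Psi hc ?_
    rw [norm_smul, norm_inv, Real.norm_ofNat]
    linarith
  linarith

lemma Psi_two_pow_mul_le (hν : IsSymmetricLevyMeasure ν) (hc : Continuous (Phi ν)) {r : ℝ}
    (hr : 0 ≤ r) (n : ℕ) : Psi ν (2 ^ n * r) ≤ 4 ^ n * Psi ν r := by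
  induction n with
  | zero => simp
  | succ n ih =>
    have := Psi_two_mul_le hν hc (r := 2 ^ n * r) (by positivity)
    rw [pow_succ', pow_succ', mul_assoc, mul_assoc]
    linarith

lemma Psi_one_pos (hν : IsSymmetricLevyMeasure ν) (hc : Continuous (Phi ν))
    (hub : ∀ B, ∃ ξ, B < Phi ν ξ) : 0 < Psi ν 1 := by
  by_contra! h0
  obtain ⟨ξ, hξ⟩ := hub 0
  obtain ⟨n, hn⟩ := pow_unbounded_of_one_lt ‖ξ‖ (one_lt_two)
  have h1 := Psi_two_pow_mul_le hν hc zero_le_one n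
  rw [mul_one] at h1
  have h2 := Phi_le_Psi hc hn.le
  nlinarith [pow_pos (four_pos (α := ℝ)) n]

/-- Doubling `r` about `log₂(1/r)` times reaches 1, and each doubling multiplies `Ψ` by at most 4;
the overshoot of at most one doubling accounts for the constant `1/4`. -/
lemma quadratic_le_Psi (hν : IsSymmetricLevyMeasure ν) (hc : Continuous (Phi ν)) {r : ℝ}
    (hr : 0 < r) (hr1 : r ≤ 1) : Psi ν 1 / 4 * r ^ 2 ≤ Psi ν r := by
  obtain ⟨n, hn, hn'⟩ := exists_nat_pow_near (one_le_inv₀ hr |>.2 hr1) (one_lt_two)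
  have h1 : Psi ν 1 ≤ 4 ^ (n + 1) * Psi ν r := by
    refine (Psi_mono hc zero_le_one ?_).trans (Psi_two_pow_mul_le hν hc hr.le (n + 1))
    rw [inv_lt_iff_one_lt_mul₀ hr] at hn'
    linarith
  have h2 : (4 : ℝ) ^ n * r ^ 2 ≤ 1 := by
    rw [le_inv_comm₀ (by positivity) hr, ← one_div, le_div_iff₀ (by positivity)] at hn
    calc (4 : ℝ) ^ n * r ^ 2 = (r * 2 ^ n) ^ 2 := by
          rw [mul_pow, ← pow_mul, mul_comm n 2, pow_mul]; norm_num; ring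
      _ ≤ 1 := pow_le_one₀ (by positivity) hn
  have h3 := Psi_nonneg hc hr.le
  have h4 : Psi ν 1 * r ^ 2 ≤ 4 * (4 ^ n * r ^ 2) * Psi ν r := by
    rw [pow_succ] at h1
    nlinarith [mul_le_mul_of_nonneg_right h1 (sq_nonneg r)]
  nlinarith

lemma PsiInv_spec (hc : Continuous (Phi ν)) (hub : ∀ B, ∃ ξ, B < Phi ν ξ) {s : ℝ} (hs : 0 < s) :
    0 < PsiInv ν s ∧ Psi ν (PsiInv ν s) = s := by
  obtain ⟨ξ, hξ⟩ := hub s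
  have hR : s < Psi ν ‖ξ‖ := hξ.trans_le (Phi_le_Psi hc le_rfl)
  -- Since `Ψ(0) = 0 ≠ s`, the condition `0 < r` may be relaxed to `0 ≤ r`; the set is then visibly
  -- closed and contains its supremum.
  have hset : {r : ℝ | 0 < r ∧ Psi ν r = s} = Ici 0 ∩ Psi ν ⁻¹' {s} := by
    ext r
    simp only [mem_ofPred_eq, mem_inter_iff, mem_Ici, mem_preimage, mem_singleton_iff]
    refine ⟨fun h => ⟨h.1.le, h.2⟩, fun h => ⟨h.1.lt_of_ne ?_, h.2⟩⟩
    rintro rfl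
    rw [Psi_zero] at h
    exact hs.ne h.2
  have hcl : IsClosed {r : ℝ | 0 < r ∧ Psi ν r = s} := by
    rw [hset]
    exact (continuousOn_Psi hc).preimage_isClosed_of_isClosed isClosed_Ici isClosed_singleton
  have hne : {r : ℝ | 0 < r ∧ Psi ν r = s}.Nonempty := by
    have := intermediate_value_Icc (norm_nonneg ξ)
      ((continuousOn_Psi hc).mono Icc_subset_Ici_self)
    obtain ⟨r, hr, hrs⟩ := this ⟨by rw [Psi_zero]; exact hs.le, hR.le⟩
    rw [hset]
    exact ⟨r, hr.1, hrs⟩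
  have hbdd : BddAbove {r : ℝ | 0 < r ∧ Psi ν r = s} := by
    refine ⟨‖ξ‖, fun r hr => ?_⟩
    by_contra! hlt
    have := Psi_mono hc (norm_nonneg ξ) hlt.le
    linarith [hr.2]
  exact hcl.csSup_mem hne hbdd

lemma h_pos (hc : Continuous (Phi ν)) (hub : ∀ B, ∃ ξ, B < Phi ν ξ) {t : ℝ} (ht : 0 < t) :
    0 < h ν t :=
  one_div_pos.2 (PsiInv_spec hc hub (one_div_pos.2 ht)).1

lemma Psi_inv_h (hc : Continuous (Phi ν)) (hub : ∀ B, ∃ ξ, B < Phi ν ξ) {t : ℝ} (ht : 0 < t) :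
    Psi ν (h ν t)⁻¹ = t⁻¹ := by
  rw [h, one_div, inv_inv, one_div]
  exact (PsiInv_spec hc hub (inv_pos.2 ht)).2

lemma h_mono (hc : Continuous (Phi ν)) (hub : ∀ B, ∃ ξ, B < Phi ν ξ) {s t : ℝ} (hs : 0 < s)
    (hst : s ≤ t) : h ν s ≤ h ν t := by
  rcases hst.eq_or_lt with rfl | hst
  · rfl
  have ht := hs.trans hst
  by_contra! hlt
  have h1 := Psi_mono hc (inv_pos.2 (h_pos hc hub hs)).le
    (inv_anti₀ (h_pos hc hub ht) hlt.le)
  rw [Psi_inv_h hc hub hs, Psi_inv_h hc hub ht] at h1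
  exact absurd (inv_strictAnti₀ hs hst) (not_lt.2 h1)

/-- This is the quadratic lower bound for `Ψ` at `r = 1/h(t)`, where `Ψ(r) = 1/t`. That bound needs
`r ≤ 1`, which `t ≥ 2/Ψ(1)` ensures. -/
lemma exists_mul_le_h_sq (hν : IsSymmetricLevyMeasure ν) (hc : Continuous (Phi ν))
    (hub : ∀ B, ∃ ξ, B < Phi ν ξ) :
    ∃ c t₀ : ℝ, 0 < c ∧ 0 < t₀ ∧ ∀ t, t₀ ≤ t → c * t ≤ h ν t ^ 2 := by
  have h1 := Psi_one_pos hν hc hub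
  refine ⟨Psi ν 1 / 4, 2 / Psi ν 1, by positivity, by positivity, fun t ht => ?_⟩
  have ht0 : 0 < t := lt_of_lt_of_le (by positivity) ht
  have hh := h_pos hc hub ht0
  have hh1 : (h ν t)⁻¹ ≤ 1 := by
    by_contra! hlt
    have h2 := Psi_mono hc zero_le_one hlt.le
    rw [Psi_inv_h hc hub ht0] at h2
    rw [div_le_iff₀ h1] at ht
    have := (le_inv_comm₀ h1 ht0).1 h2
    rw [← one_div, le_div_iff₀ h1] at this
    linarith
  have h3 := quadratic_le_Psi hν hc (inv_pos.2 hh) hh1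
  rw [Psi_inv_h hc hub ht0, inv_pow, ← div_eq_mul_inv, div_le_iff₀ (by positivity),
    ← div_eq_inv_mul, le_div_iff₀ ht0] at h3
  exact h3

end Psi

/-! ### Near-diagonal bound, Chapman–Kolmogorov and chaining -/

lemma one_sub_abs_le_cos (u : ℝ) : 1 - |u| ≤ Real.cos u := by
  rcases le_total |u| 2 with h | h
  · have h1 := Real.one_sub_sq_div_two_le_cos (x := u)
    rw [← sq_abs] at h1
    nlinarith [abs_nonneg u]
  · linarith [Real.neg_one_le_cos u]

section LowerBounds

variable {d : ℕ} {ν : Measure (EuclideanSpace ℝ (Fin d))}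

lemma FourierCondition.integrable_exp_mul_norm (hc : Continuous (Phi ν))
    (hA : FourierCondition ν ∞) {t : ℝ} (ht : 0 < t) :
    Integrable fun ξ : EuclideanSpace ℝ (Fin d) => Real.exp (-t * Phi ν ξ) * ‖ξ‖ := by
  obtain ⟨M₀, -, hM⟩ := hA
  refine ⟨by fun_prop, ?_⟩
  rw [hasFiniteIntegral_iff_ofReal (ae_of_all _ fun y => by positivity)]
  exact (hM t ht ENNReal.ofReal_lt_top).trans_lt ENNReal.ofReal_lt_top

lemma FourierCondition.integrable_exp (hc : Continuous (Phi ν))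
    (hA : FourierCondition ν ∞) {t : ℝ} (ht : 0 < t) :
    Integrable fun ξ : EuclideanSpace ℝ (Fin d) => Real.exp (-t * Phi ν ξ) := by
  have h1 : Integrable ((Metric.closedBall (0 : EuclideanSpace ℝ (Fin d)) 1).indicator
      fun _ => (1 : ℝ)) :=
    (integrable_indicator_iff measurableSet_closedBall).2
      (integrableOn_const measure_closedBall_lt_top.ne)
  refine (h1.add (hA.integrable_exp_mul_norm hc ht)).mono' (by fun_prop)
    (ae_of_all _ fun ξ => ?_)
  rw [Real.norm_of_nonneg (Real.exp_pos _).le, Pi.add_apply]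
  by_cases hξ : ‖ξ‖ ≤ 1
  · rw [indicator_of_mem (mem_closedBall_zero_iff.2 hξ)]
    have : Real.exp (-t * Phi ν ξ) ≤ 1 := by
      rw [Real.exp_le_one_iff]
      nlinarith [Phi_nonneg ν ξ]
    have : 0 ≤ Real.exp (-t * Phi ν ξ) * ‖ξ‖ := by positivity
    linarith
  · rw [indicator_of_notMem (by rwa [mem_closedBall_zero_iff]), zero_add]
    exact le_mul_of_one_le_right (Real.exp_pos _).le (not_le.1 hξ).le

/-- On the scale `h t` around the origin, the density is at least of order `h t ^ (-d)`. -/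
lemma exists_near_diagonal_le (hc : Continuous (Phi ν)) (hub : ∀ B, ∃ ξ, B < Phi ν ξ)
    (hA : FourierCondition ν ∞) :
    ∃ a θ : ℝ, 0 < a ∧ 0 < θ ∧ ∀ t, 0 < t → ∀ x : EuclideanSpace ℝ (Fin d), ‖x‖ ≤ θ * h ν t →
      a * h ν t ^ (-(d : ℤ)) ≤ fourierDensity (fun ξ => Real.exp (-t * Phi ν ξ)) x := by
  have hA' := hA
  obtain ⟨M₀, hM0, hM⟩ := hA'
  set V := (volume : Measure (EuclideanSpace ℝ (Fin d))).real (Metric.closedBall 0 1) with hV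
  have hVpos : 0 < V := ENNReal.toReal_pos (Metric.measure_closedBall_pos _ _ one_pos).ne'
    measure_closedBall_lt_top.ne
  -- The main term is at least `e^{-1} V h(t)^{-d}`; `θ` makes the error at most half of this, and
  -- `a` records the remaining half.
  refine ⟨((2 * Real.pi) ^ d)⁻¹ * (Real.exp (-1) * V / 2), Real.exp (-1) * V / (2 * M₀),
    by positivity, by positivity, fun t ht x hx => ?_⟩
  have hh := h_pos hc hub ht
  have hi1 := hA.integrable_exp hc ht
  have hi2 := hA.integrable_exp_mul_norm hc ht
  have e1 : ∫ ξ : EuclideanSpace ℝ (Fin d), Real.exp (-t * Phi ν ξ) * ‖ξ‖ ≤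
      M₀ * h ν t ^ (-(d : ℤ) - 1) := by
    rw [integral_eq_lintegral_of_nonneg_ae (ae_of_all _ fun ξ => by positivity)
      hi2.aestronglyMeasurable]
    exact ENNReal.toReal_le_of_le_ofReal (by positivity) (hM t ht ENNReal.ofReal_lt_top)
  have e2 : Real.exp (-1) * V * h ν t ^ (-(d : ℤ)) ≤
      ∫ ξ : EuclideanSpace ℝ (Fin d), Real.exp (-t * Phi ν ξ) := by
    have hvol : (volume : Measure (EuclideanSpace ℝ (Fin d))).real
        (Metric.closedBall 0 (h ν t)⁻¹) = V * h ν t ^ (-(d : ℤ)) := by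
      rw [hV, measureReal_def, Measure.addHaar_closedBall' _ _ (inv_pos.2 hh).le,
        ENNReal.toReal_mul, ENNReal.toReal_ofReal (by positivity), finrank_euclideanSpace_fin,
        measureReal_def, zpow_neg, zpow_natCast, inv_pow, mul_comm]
    calc Real.exp (-1) * V * h ν t ^ (-(d : ℤ))
        = ∫ _ in Metric.closedBall (0 : EuclideanSpace ℝ (Fin d)) (h ν t)⁻¹, Real.exp (-1) := by
          rw [setIntegral_const, hvol, smul_eq_mul]; ring
      _ ≤ ∫ ξ in Metric.closedBall (0 : EuclideanSpace ℝ (Fin d)) (h ν t)⁻¹,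
            Real.exp (-t * Phi ν ξ) := by
          refine setIntegral_mono_on (integrableOn_const measure_closedBall_lt_top.ne)
            hi1.integrableOn measurableSet_closedBall fun ξ hξ => Real.exp_le_exp.2 ?_
          have h1 := Phi_le_Psi hc (mem_closedBall_zero_iff.1 hξ)
          rw [Psi_inv_h hc hub ht] at h1
          have h2 := mul_le_mul_of_nonneg_left h1 ht.le
          rw [mul_inv_cancel₀ ht.ne'] at h2
          linarith
      _ ≤ _ := setIntegral_le_integral hi1 (ae_of_all _ fun ξ => (Real.exp_pos _).le)
  have e3 : (∫ ξ : EuclideanSpace ℝ (Fin d), Real.exp (-t * Phi ν ξ)) -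
      ‖x‖ * ∫ ξ : EuclideanSpace ℝ (Fin d), Real.exp (-t * Phi ν ξ) * ‖ξ‖ ≤
      ∫ ξ, Real.cos ⟪x, ξ⟫ * Real.exp (-t * Phi ν ξ) := by
    rw [← integral_const_mul, ← integral_sub hi1 (hi2.const_mul _)]
    refine integral_mono (hi1.sub (hi2.const_mul _)) (integrable_cos_mul hi1 x) fun ξ => ?_
    have h1 := one_sub_abs_le_cos ⟪x, ξ⟫
    have h2 := abs_real_inner_le_norm x ξ
    have h3 := mul_le_mul_of_nonneg_right (h1.trans' (sub_le_sub_left h2 1))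
      (Real.exp_pos (-t * Phi ν ξ)).le
    simp only
    linarith
  have e4 : ‖x‖ * ∫ ξ : EuclideanSpace ℝ (Fin d), Real.exp (-t * Phi ν ξ) * ‖ξ‖ ≤
      Real.exp (-1) * V / 2 * h ν t ^ (-(d : ℤ)) := by
    calc _ ≤ (Real.exp (-1) * V / (2 * M₀) * h ν t) * (M₀ * h ν t ^ (-(d : ℤ) - 1)) :=
          mul_le_mul hx e1 (integral_nonneg fun ξ => by positivity) (by positivity)
      _ = _ := by
          rw [zpow_sub_one₀ hh.ne']
          field_simp
  rw [fourierDensity, mul_assoc]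
  refine mul_le_mul_of_nonneg_left ?_ (by positivity)
  linarith

lemma IsLevySemigroup.integral_cos_sub {P : ℝ → Measure (EuclideanSpace ℝ (Fin d))}
    (hP : IsLevySemigroup ν P) {t : ℝ} (ht : 0 ≤ t) (x ξ : EuclideanSpace ℝ (Fin d)) :
    ∫ y, Real.cos ⟪x - y, ξ⟫ ∂(P t) = Real.cos ⟪x, ξ⟫ * Real.exp (-t * Phi ν ξ) := by
  have := hP.isProbabilityMeasure t ht
  have hi : Integrable (fun y => Complex.exp (⟪y, ξ⟫ * Complex.I)) (P t) :=
    (integrable_const (1 : ℝ)).mono' (by fun_prop)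
      (ae_of_all _ fun y => (Complex.norm_exp_ofReal_mul_I _).le)
  have h1 := hP.charFun_eq_ofReal ht ξ
  rw [charFun_apply] at h1
  have hre : ∫ y, Real.cos ⟪y, ξ⟫ ∂(P t) = Real.exp (-t * Phi ν ξ) := by
    have := congrArg Complex.re h1
    rw [← RCLike.re_eq_complex_re, ← integral_re hi] at this
    simpa only [RCLike.re_eq_complex_re, Complex.exp_ofReal_mul_I_re, Complex.ofReal_re] using this
  -- The characteristic function is real.
  have him : ∫ y, Real.sin ⟪y, ξ⟫ ∂(P t) = 0 := by
    have := congrArg Complex.im h1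
    rw [← RCLike.im_eq_complex_im, ← integral_im hi] at this
    simpa only [RCLike.im_eq_complex_im, Complex.exp_ofReal_mul_I_im, Complex.ofReal_im] using this
  have hc : Integrable (fun y => Real.cos ⟪y, ξ⟫) (P t) :=
    (integrable_const (1 : ℝ)).mono' (by fun_prop) (ae_of_all _ fun y => Real.abs_cos_le_one _)
  have hs : Integrable (fun y => Real.sin ⟪y, ξ⟫) (P t) :=
    (integrable_const (1 : ℝ)).mono' (by fun_prop) (ae_of_all _ fun y => Real.abs_sin_le_one _)
  simp only [inner_sub_left, Real.cos_sub]
  rw [integral_add (hc.const_mul _) (hs.const_mul _), integral_const_mul, integral_const_mul, hre,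
    him]
  ring

/-- The Chapman–Kolmogorov identity for the densities. -/
lemma IsLevySemigroup.fourierDensity_add {P : ℝ → Measure (EuclideanSpace ℝ (Fin d))}
    (hP : IsLevySemigroup ν P) (hA : FourierCondition ν ∞) {s t : ℝ} (hs : 0 < s) (ht : 0 ≤ t)
    (x : EuclideanSpace ℝ (Fin d)) :
    fourierDensity (fun ξ => Real.exp (-(s + t) * Phi ν ξ)) x =
      ∫ y, fourierDensity (fun ξ => Real.exp (-s * Phi ν ξ)) (x - y) ∂(P t) := by
  have := hP.isProbabilityMeasure t ht
  have hc := hP.continuous_Phi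
  unfold fourierDensity
  -- Fubini in the inversion formula yields the identity at every `x`, not merely almost everywhere.
  rw [integral_const_mul, integral_integral_swap]
  · congr 2 with ξ
    rw [integral_mul_const, hP.integral_cos_sub ht]
    beta_reduce
    rw [neg_add, add_mul, Real.exp_add]
    ring
  · have h1 : Integrable (fun p : EuclideanSpace ℝ (Fin d) × EuclideanSpace ℝ (Fin d) =>
        Real.exp (-s * Phi ν p.2)) ((P t).prod volume) :=
      (hA.integrable_exp hc hs).comp_snd (P t)
    refine h1.mono' (by fun_prop) (ae_of_all _ fun p => ?_)
    simp only [Function.uncurry, norm_mul, Real.norm_of_nonneg (Real.exp_pos _).le]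
    exact mul_le_of_le_one_left (Real.exp_pos _).le (Real.abs_cos_le_one _)

lemma IsLevySemigroup.isContinuousDensity {P : ℝ → Measure (EuclideanSpace ℝ (Fin d))}
    (hP : IsLevySemigroup ν P) (hA : FourierCondition ν ∞) {t : ℝ} (ht : 0 < t) :
    IsContinuousDensity (P t) (fourierDensity fun ξ => Real.exp (-t * Phi ν ξ)) :=
  have := hP.isProbabilityMeasure t ht.le
  isContinuousDensity_fourierDensity (P t) (hA.integrable_exp hP.continuous_Phi ht)
    (hP.charFun_eq_ofReal ht.le)

/-- A lower bound for the density at time `s` on a ball propagates along chains of balls. -/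
lemma IsLevySemigroup.chain_le {P : ℝ → Measure (EuclideanSpace ℝ (Fin d))}
    (hP : IsLevySemigroup ν P) (hA : FourierCondition ν ∞) {s ρ A : ℝ} (hs : 0 < s) (hρ : 0 < ρ)
    (hA0 : 0 ≤ A)
    (hbound : ∀ x, ‖x‖ ≤ ρ → A ≤ fourierDensity (fun ξ => Real.exp (-s * Phi ν ξ)) x) (k : ℕ) :
    ∀ x : EuclideanSpace ℝ (Fin d), ‖x‖ ≤ (k + 2) * ρ / 2 →
      A * (A * (volume : Measure (EuclideanSpace ℝ (Fin d))).real
          (Metric.closedBall 0 (ρ / 4))) ^ k ≤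
        fourierDensity (fun ξ => Real.exp (-((k + 1) * s) * Phi ν ξ)) x := by
  induction k with
  | zero =>
    intro x hx
    simpa using hbound x (hx.trans (by norm_num))
  | succ k ih =>
    intro x hx
    push_cast at hx ⊢
    set v := (volume : Measure (EuclideanSpace ℝ (Fin d))).real (Metric.closedBall 0 (ρ / 4))
      with hv
    set m := A * (A * v) ^ k with hm
    have hm0 : 0 ≤ m := by positivity
    have ht : 0 < ((k : ℝ) + 1) * s := by positivity
    have := hP.isProbabilityMeasure _ ht.le
    have hdens := hP.isContinuousDensity hA ht
    have hdens_s := hP.isContinuousDensity hA hs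
    -- For `|x| ≤ (k+3)ρ/2` this gives `|lam x| ≤ (k+2)ρ/2 - ρ/4` and `|x - lam x| ≤ ρ - ρ/4`,
    -- leaving room for the radius `ρ/4` in both bounds.
    set lam : ℝ := (2 * k + 3) / (2 * (k + 3)) with hlam
    have hlam0 : 0 ≤ lam := by positivity
    have hlam1 : 1 - lam = 3 / (2 * (k + 3)) := by
      rw [hlam]; field_simp; ring
    set B := Metric.closedBall (lam • x) (ρ / 4) with hB
    have hx' : ‖x‖ ≤ (k + 3) * ρ / 2 := by linarith
    have hBz : ∀ z ∈ B, ‖z‖ ≤ (k + 2) * ρ / 2 ∧ ‖x - z‖ ≤ ρ := by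
      intro z hz
      rw [hB, mem_closedBall_iff_norm] at hz
      have n1 : ‖lam • x‖ ≤ (2 * k + 3) * ρ / 4 := by
        rw [norm_smul, Real.norm_of_nonneg hlam0]
        refine (mul_le_mul_of_nonneg_left hx' hlam0).trans_eq ?_
        rw [hlam]; field_simp; ring
      have n2 : ‖x - lam • x‖ ≤ 3 * ρ / 4 := by
        have : x - lam • x = (1 - lam) • x := by rw [sub_smul, one_smul]
        rw [this, norm_smul, hlam1, Real.norm_of_nonneg (by positivity)]
        refine (mul_le_mul_of_nonneg_left hx' (by positivity)).trans_eq ?_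
        field_simp; ring
      constructor
      · have := norm_add_le (lam • x) (z - lam • x)
        rw [add_sub_cancel] at this
        linarith
      · have := norm_sub_le (x - lam • x) (z - lam • x)
        rw [sub_sub_sub_cancel_right] at this
        linarith
    have hPB : m * v ≤ (P ((k + 1) * s)).real B := by
      have h1 : ENNReal.ofReal m * volume B ≤ P ((k + 1) * s) B := by
        rw [hdens.eq_withDensity, withDensity_apply _ measurableSet_closedBall,
          ← setLIntegral_const]
        exact setLIntegral_mono' measurableSet_closedBall fun z hz =>
          ENNReal.ofReal_le_ofReal (ih z (hBz z hz).1)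
      have h2 := ENNReal.toReal_mono (measure_ne_top _ _) h1
      rw [ENNReal.toReal_mul, ENNReal.toReal_ofReal hm0, hB, Measure.addHaar_closedBall_center]
        at h2
      exact h2
    have hfi : Integrable (fun y => fourierDensity (fun ξ => Real.exp (-s * Phi ν ξ)) (x - y))
        (P ((k + 1) * s)) := by
      have hi := hA.integrable_exp hP.continuous_Phi hs
      refine (integrable_const
        (((2 * Real.pi) ^ d)⁻¹ * ∫ ξ, ‖Real.exp (-s * Phi ν ξ)‖)).mono'
        (hdens_s.continuous.comp (by fun_prop)).aestronglyMeasurable (ae_of_all _ fun y => ?_)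
      rw [fourierDensity, norm_mul, Real.norm_of_nonneg (by positivity)]
      refine mul_le_mul_of_nonneg_left ?_ (by positivity)
      refine norm_integral_le_of_norm_le hi.norm (ae_of_all _ fun ξ => ?_)
      rw [norm_mul]
      exact mul_le_of_le_one_left (norm_nonneg _) (Real.abs_cos_le_one _)
    have e : ((k : ℝ) + 1 + 1) * s = s + (k + 1) * s := by ring
    rw [e, hP.fourierDensity_add hA hs ht.le]
    calc A * (A * v) ^ (k + 1) = A * (m * v) := by rw [hm]; ring
      _ ≤ A * (P ((k + 1) * s)).real B := mul_le_mul_of_nonneg_left hPB hA0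
      _ = ∫ _ in B, A ∂(P ((k + 1) * s)) := by rw [setIntegral_const, smul_eq_mul, mul_comm]
      _ ≤ ∫ y in B, fourierDensity (fun ξ => Real.exp (-s * Phi ν ξ)) (x - y)
            ∂(P ((k + 1) * s)) :=
          setIntegral_mono_on (integrableOn_const (measure_ne_top _ _)) hfi.integrableOn
            measurableSet_closedBall fun z hz => hbound _ (hBz z hz).2
      _ ≤ _ := setIntegral_le_integral hfi (ae_of_all _ fun y => hdens_s.nonneg _)

end LowerBounds

end LevyDensity

/-! ### Choice of the number of links -/

theorem theorem1 (d : ℕ) (hd : 1 ≤ d)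
    (ν : Measure (EuclideanSpace ℝ (Fin d)))
    (hν : LevyDensity.IsSymmetricLevyMeasure ν)
    (hA : LevyDensity.FourierCondition ν ∞)
    (P : ℝ → Measure (EuclideanSpace ℝ (Fin d)))
    (hP : LevyDensity.IsLevySemigroup ν P) :
    ∃ p : ℝ → EuclideanSpace ℝ (Fin d) → ℝ,
      (∀ t : ℝ, 0 < t → LevyDensity.IsContinuousDensity (P t) (p t)) ∧
      ∃ c₁ c₂ c₃ c₄ : ℝ, 0 < c₁ ∧ 0 < c₂ ∧ 0 < c₃ ∧ 0 < c₄ ∧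
        ∀ t : ℝ, c₃ < t → ∀ x : EuclideanSpace ℝ (Fin d), ‖x‖ ≤ c₄ * t →
          c₁ * LevyDensity.h ν t ^ (-(d : ℤ)) * Real.exp (-c₂ * ‖x‖ ^ 2 / t) ≤ p t x := by
  have hc := hP.continuous_Phi
  have hub := hA.exists_lt_Phi hd
  obtain ⟨a, θ, ha, hθ, hdiag⟩ := LevyDensity.exists_near_diagonal_le hc hub hA
  obtain ⟨c, t₀, hc0, ht₀, hsq⟩ := LevyDensity.exists_mul_le_h_sq hν hc hub
  refine ⟨fun t => LevyDensity.fourierDensity fun ξ => Real.exp (-t * LevyDensity.Phi ν ξ),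
    fun t ht => hP.isContinuousDensity hA ht, ?_⟩
  set V := (volume : Measure (EuclideanSpace ℝ (Fin d))).real (Metric.closedBall 0 1) with hV
  have hVpos : 0 < V := ENNReal.toReal_pos (Metric.measure_closedBall_pos _ _ one_pos).ne'
    measure_closedBall_lt_top.ne
  -- The cost of one link: the bound `a H^{-d}` times the volume of a ball of radius `θH/4`.
  set q := a * (V * (θ / 4) ^ d) with hq
  have hqpos : 0 < q := by positivity
  -- Chosen so that `k + 1 > L|x|²/t`, together with `H² ≥ cs`, gives `|x| ≤ (k+1)θH/2`.
  set L := 4 / (θ ^ 2 * c) with hL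
  have hLpos : 0 < L := by positivity
  -- With this `c₄`, `k t₀ ≤ t/2`; with `c₃ = 2t₀`, also `t₀ ≤ t/2`. Together they give `s ≥ t₀`.
  -- The `+ 1` keeps `c₂` positive even when `q = 1`.
  refine ⟨a, (|Real.log q| + 1) * L, 2 * t₀, √(1 / (2 * L * t₀)), ha, by positivity,
    by positivity, by positivity, fun t ht x hx => ?_⟩
  have htpos : 0 < t := by linarith
  set k := ⌊L * ‖x‖ ^ 2 / t⌋₊ with hk
  have hk1 : (k : ℝ) ≤ L * ‖x‖ ^ 2 / t := Nat.floor_le (by positivity)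
  have hk2 : L * ‖x‖ ^ 2 / t < k + 1 := Nat.lt_floor_add_one _
  set s := t / (k + 1) with hs
  have hspos : 0 < s := by positivity
  have hks : ((k : ℝ) + 1) * s = t := by rw [hs]; field_simp
  have hst : s ≤ t := div_le_self htpos.le (by linarith [k.cast_nonneg (α := ℝ)])
  have hst₀ : t₀ ≤ s := by
    rw [hs, le_div_iff₀ (by positivity)]
    have h1 : ‖x‖ ^ 2 ≤ 1 / (2 * L * t₀) * t ^ 2 := by
      rw [← Real.sq_sqrt (show 0 ≤ 1 / (2 * L * t₀) by positivity), ← mul_pow]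
      exact pow_le_pow_left₀ (norm_nonneg _) hx 2
    have h2 : L * ‖x‖ ^ 2 / t ≤ t / (2 * t₀) := by
      rw [div_le_iff₀ htpos]
      refine (mul_le_mul_of_nonneg_left h1 hLpos.le).trans_eq ?_
      field_simp
    have h3 := mul_le_mul_of_nonneg_left (hk1.trans h2) ht₀.le
    have h4 : t₀ * (t / (2 * t₀)) = t / 2 := by field_simp
    linarith
  set H := LevyDensity.h ν s with hH
  have hHpos : 0 < H := LevyDensity.h_pos hc hub hspos
  have hxk : ‖x‖ ≤ (k + 2) * (θ * H) / 2 := by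
    have h1 : c * s ≤ H ^ 2 := hsq s hst₀
    have h2 : ‖x‖ ^ 2 ≤ ((k + 1) * (θ * H) / 2) ^ 2 := by
      have h3 : ‖x‖ ^ 2 ≤ (k + 1) * (θ ^ 2 * c) / 4 * t := by
        rw [div_lt_iff₀ htpos, hL, div_mul_eq_mul_div, div_lt_iff₀ (by positivity)] at hk2
        linarith
      calc ‖x‖ ^ 2 ≤ (k + 1) * (θ ^ 2 * c) / 4 * t := h3
        _ = (k + 1) ^ 2 * θ ^ 2 / 4 * (c * s) := by rw [← hks]; ring
        _ ≤ (k + 1) ^ 2 * θ ^ 2 / 4 * H ^ 2 := mul_le_mul_of_nonneg_left h1 (by positivity)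
        _ = _ := by ring
    have h4 := (sq_le_sq₀ (norm_nonneg x) (by positivity)).1 h2
    have h5 : 0 < θ * H := by positivity
    linarith
  have hchain := hP.chain_le hA (A := a * H ^ (-(d : ℤ))) hspos (by positivity) (by positivity)
    (hdiag s hspos) k x hxk
  have hAv : a * H ^ (-(d : ℤ)) * (volume : Measure (EuclideanSpace ℝ (Fin d))).real
      (Metric.closedBall 0 (θ * H / 4)) = q := by
    rw [measureReal_def, Measure.addHaar_closedBall' _ _ (by positivity), ENNReal.toReal_mul,
      ENNReal.toReal_ofReal (by positivity), finrank_euclideanSpace_fin, ← measureReal_def, ← hV,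
      hq, zpow_neg, zpow_natCast, div_pow, mul_pow, div_pow]
    field_simp
  rw [hAv, hks] at hchain
  refine le_trans ?_ hchain
  have hHt : LevyDensity.h ν t ^ (-(d : ℤ)) ≤ H ^ (-(d : ℤ)) := by
    rw [zpow_neg, zpow_neg, zpow_natCast, zpow_natCast]
    exact inv_anti₀ (by positivity)
      (pow_le_pow_left₀ hHpos.le (LevyDensity.h_mono hc hub hspos hst) d)
  have hexp : Real.exp (-((|Real.log q| + 1) * L) * ‖x‖ ^ 2 / t) ≤ q ^ k := by
    rw [← Real.exp_log (pow_pos hqpos k), Real.log_pow, Real.exp_le_exp]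
    have h1 : -(|Real.log q| + 1) ≤ Real.log q := by linarith [neg_abs_le (Real.log q)]
    have h2 := mul_le_mul_of_nonneg_left h1 (k.cast_nonneg (α := ℝ))
    have h3 := mul_le_mul_of_nonneg_left hk1 (show 0 ≤ |Real.log q| + 1 by positivity)
    have h4 : -((|Real.log q| + 1) * L) * ‖x‖ ^ 2 / t =
        -((|Real.log q| + 1) * (L * ‖x‖ ^ 2 / t)) := by ring
    rw [h4]
    linarith
  exact mul_le_mul (mul_le_mul_of_nonneg_left hHt ha.le) hexp (Real.exp_pos _).le (by positivity)
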